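/- Let $G$ be a locally compact Hausdorff topological group. A $G$-flow is a non-empty compact Hausdorff space $X$ with a jointly continuous action of $G$. An irreducible extension of $X$ is a $G$-flow $Y$ with a continuous $G$-equivariant surjection $\pi\colon Y\to X$ such that every non-empty open $U\subseteq Y$ contains a fiber $\pi^{-1}(\{x\})$ for some $x\in X$. Among the irreducible extensions of $X$ there is a universal one $\pi_X\colon \hat X_G\to X$, unique up to isomorphism: for every irreducible extension $\pi\colon Y\to X$ there is a continuous $G$-equivariant map $p\colon \hat X_G\to Y$ with $\pi\circ p=\pi_X$. The flow $X$ is Gleason complete if $\pi_X$ is an isomorphism. The stabilizer flow of $X$ is $\mathrm S_G(X)=\{G_z : z\in\hat X_G\}$, a set of closed subgroups of $G$, where $G_z$ is the stabilizer of $z$. A flow $X$ is free if for every $x \in X$ the map $g\mapsto g\cdot x$ is injective on $G$, and topologically free if for every compact $K\subseteq G$ with $1_G\notin K$ the set $\{x\in X : x\in K\cdot x\}$ has empty interior. For every $G$-flow $X$ the following are equivalent: 1. $X$ is topologically free; 2. $\hat X_G$ is free; 3. $\mathrm S_G(X)=\{\{1_G\}\}$. In particular, a Gleason complete $G$-flow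 is topologically free if and only if it is free. -/

import Mathlib

open Set Filter Topology

universe u v

/-! ### Freeness -/

/-- The action of `G` on `X` is free: every orbit map `g ↦ g • x` is injective. -/
def IsFreeFlow (G : Type v) (X : Type u) [Group G] [MulAction G X] : Prop :=
  ∀ x : X, Function.Injective (fun g : G => g • x)

/-- The action of `G` on `X` is topologically free: for every compact `K ⊆ G` with `1 ∉ K`,
the set `{x | x ∈ K • x}` has empty interior. -/
def IsTopologicallyFreeFlow (G : Type v) (X : Type u) [Group G] [TopologicalSpace G]
    [TopologicalSpace X] [MulAction G X] : Prop :=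
  ∀ K : Set G, IsCompact K → (1 : G) ∉ K → interior {x : X | ∃ k ∈ K, k • x = x} = ∅

/-! ### Irreducible maps and irreducible extensions -/

/-- A map is irreducible if every nonempty open subset of the source contains a fiber
`π ⁻¹ {x}` for some `x` in the target. (Used here for surjective continuous maps between compact
Hausdorff spaces only.) -/
def IsIrreducibleMap {Y : Type*} {X : Type*} [TopologicalSpace Y] (π : Y → X) : Prop :=
  ∀ U : Set Y, IsOpen U → U.Nonempty → ∃ x : X, π ⁻¹' {x} ⊆ U

/-- An irreducible extension of the `G`-flow `X`: a `G`-flow `carrier` (a compact Hausdorff space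
with a jointly continuous action of `G`) together with a continuous, `G`-equivariant, surjective
and irreducible map `π` onto `X`. -/
structure IrreducibleExtension (G : Type v) (X : Type u) [Group G] [TopologicalSpace G]
    [TopologicalSpace X] [MulAction G X] where
  carrier : Type u
  [topology : TopologicalSpace carrier]
  [compact : CompactSpace carrier]
  [hausdorff : T2Space carrier]
  [action : MulAction G carrier]
  [continuousAction : ContinuousSMul G carrier]
  π : carrier → X
  continuous_π : Continuous π
  equivariant_π : ∀ (g : G) (y : carrier), π (g • y) = g • π y
  surjective_π : Function.Surjective π
  irreducible_π : IsIrreducibleMap π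

attribute [instance] IrreducibleExtension.topology IrreducibleExtension.compact
  IrreducibleExtension.hausdorff IrreducibleExtension.action
  IrreducibleExtension.continuousAction

/-- The universal property: every irreducible extension `F` of `X` is a factor of `E` over `X`. -/
def IrreducibleExtension.IsUniversal {G : Type v} {X : Type u} [Group G] [TopologicalSpace G]
    [TopologicalSpace X] [MulAction G X] (E : IrreducibleExtension G X) : Prop :=
  ∀ F : IrreducibleExtension G X, ∃ p : E.carrier → F.carrier,
    Continuous p ∧ (∀ (g : G) (y : E.carrier), p (g • y) = g • p y) ∧
      ∀ y : E.carrier, F.π (p y) = E.π y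

/-! ### Construction of the universal irreducible extension

`X̂_G` is realized inside the product of all irreducible extensions of `X`, as the set of those
families of points any finitely many of whose neighborhoods contain a common fiber. As this
product lives in a large universe, the result is then moved back to the universe of `X`. -/

section Construction

/-- `fiberCore π U` is the set of points whose fiber lies in `U`. -/
def fiberCore {Y : Type*} {X : Type*} (π : Y → X) (U : Set Y) : Set X :=
  {x | π ⁻¹' {x} ⊆ U}

theorem fiberCore_isOpen {Y : Type*} {X : Type*} [TopologicalSpace Y] [TopologicalSpace X]
    [CompactSpace Y] [T2Space X] {π : Y → X} (hc : Continuous π) {U : Set Y} (hU : IsOpen U) :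
    IsOpen (fiberCore π U) := by
  have h : fiberCore π U = (π '' Uᶜ)ᶜ := by
    ext x
    simp only [fiberCore, mem_ofPred_eq, mem_compl_iff, mem_image, not_exists, not_and]
    constructor
    · intro h y hy hyx
      exact hy (h hyx)
    · intro h y hyx
      by_contra hy
      exact h y hy hyx
  rw [h]
  exact ((hU.isClosed_compl.isCompact.image hc).isClosed).isOpen_compl

/-- The image of an open set is contained in the closure of its fiber core. -/
theorem image_subset_closure_fiberCore {Y : Type*} {X : Type*} [TopologicalSpace Y]
    [TopologicalSpace X] {π : Y → X} (hc : Continuous π) (hs : Function.Surjective π)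
    (hi : IsIrreducibleMap π) {U : Set Y} (hU : IsOpen U) {y : Y} (hy : y ∈ U) :
    π y ∈ closure (fiberCore π U) := by
  rw [mem_closure_iff]
  intro W hW hyW
  obtain ⟨x, hx⟩ := hi (U ∩ π ⁻¹' W) (hU.inter (hW.preimage hc)) ⟨y, hy, hyW⟩
  obtain ⟨y', rfl⟩ := hs x
  exact ⟨π y', (hx (by simp : y' ∈ _)).2, fun z hz => (hx hz).1⟩

/-- An irreducible compact Hausdorff extension of `X` has at most as many points as `X` has
families of subsets. -/
theorem small_of_irreducible (X : Type u) {Y : Type*} [TopologicalSpace Y] [T2Space Y] {π : Y → X}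
    (hs : Function.Surjective π) (hi : IsIrreducibleMap π) : Small.{u} Y := by
  let c : Y → Set (Set X) := fun y => {A | ∃ U, IsOpen U ∧ y ∈ U ∧ A = fiberCore π U}
  refine small_of_injective (f := c) fun y y' h => ?_
  by_contra hne
  obtain ⟨U, U', hU, hU', hy, hy', hd⟩ := t2_separation hne
  have h1 : fiberCore π U ∈ c y' := h ▸ ⟨U, hU, hy, rfl⟩
  obtain ⟨W, hW, hyW, hWU⟩ := h1
  obtain ⟨x, hx⟩ := hi (W ∩ U') (hW.inter hU') ⟨y', hyW, hy'⟩
  have h2 : x ∈ fiberCore π U := hWU ▸ fun z hz => (hx hz).1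
  obtain ⟨z, hz⟩ := hs x
  exact hd.le_bot ⟨h2 hz, (hx hz).2⟩

variable (G : Type v) (X : Type u) [Group G] [TopologicalSpace G]
  [TopologicalSpace X] [MulAction G X]

/-- The product of all irreducible extensions of `X`. -/
abbrev IrreducibleExtension.Product : Type (max (u + 1) v) :=
  ∀ E : IrreducibleExtension G X, E.carrier

/-- The points of the universal irreducible extension, in a large universe. -/
def univIrrSet : Set (IrreducibleExtension.Product G X) :=
  {y | ∀ (F : Finset (IrreducibleExtension G X))
      (U : ∀ E : IrreducibleExtension G X, Set E.carrier),
      (∀ E ∈ F, IsOpen (U E) ∧ y E ∈ U E) → ∃ x : X, ∀ E ∈ F, x ∈ fiberCore E.π (U E)}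

theorem univIrrSet_isClosed : IsClosed (univIrrSet G X) := by
  rw [← isOpen_compl_iff, isOpen_iff_mem_nhds]
  intro y hy
  simp only [univIrrSet, mem_compl_iff, mem_ofPred_eq, not_forall] at hy
  obtain ⟨F, U, hU, hne⟩ := hy
  have : (F : Set (IrreducibleExtension G X)).pi U ∈ 𝓝 y :=
    set_pi_mem_nhds F.finite_toSet fun E hE => (hU E hE).1.mem_nhds (hU E hE).2
  filter_upwards [this] with z hz hz'
  exact hne (hz' F U fun E hE => ⟨(hU E hE).1, hz E hE⟩)

variable {G X} in
theorem univIrrSet_smul_mem (g : G) {y : IrreducibleExtension.Product G X}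
    (hy : y ∈ univIrrSet G X) : g • y ∈ univIrrSet G X := by
  intro F U hU
  obtain ⟨x, hx⟩ := hy F (fun E => (fun z => g • z) ⁻¹' U E) fun E hE =>
    ⟨(hU E hE).1.preimage (continuous_const_smul g), (hU E hE).2⟩
  refine ⟨g • x, fun E hE z hz => ?_⟩
  have h1 : g⁻¹ • z ∈ (fun z => g • z) ⁻¹' U E := by
    apply hx E hE
    simp only [mem_preimage, mem_singleton_iff] at hz ⊢
    rw [E.equivariant_π, hz, inv_smul_smul]
  simpa using h1

variable {G X} in
/-- All coordinates of a point of `univIrrSet` lie over the same point of `X`. -/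
theorem univIrrSet_π_eq [T2Space X] {y : IrreducibleExtension.Product G X}
    (hy : y ∈ univIrrSet G X) (E E' : IrreducibleExtension G X) :
    E.π (y E) = E'.π (y E') := by
  classical
  by_contra hne
  obtain ⟨W, W', hW, hW', hm, hm', hd⟩ := t2_separation hne
  by_cases hEE : E = E'
  · subst hEE; exact hne rfl
  obtain ⟨x, hx⟩ := hy {E, E'}
    (fun D => if D = E then D.π ⁻¹' W else D.π ⁻¹' W') (by
      intro D hD
      simp only [Finset.mem_insert, Finset.mem_singleton] at hD
      rcases hD with rfl | rfl
      · simpa using ⟨hW.preimage D.continuous_π, hm⟩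
      · simpa [Ne.symm hEE] using ⟨hW'.preimage D.continuous_π, hm'⟩)
  have h1 := hx E (by simp)
  have h2 := hx E' (by simp)
  simp only [if_true, if_neg (Ne.symm hEE)] at h1 h2
  obtain ⟨z, hz⟩ := E.surjective_π x
  obtain ⟨z', hz'⟩ := E'.surjective_π x
  have h3 : E.π z ∈ W := h1 hz
  have h4 : E'.π z' ∈ W' := h2 hz'
  rw [hz] at h3
  rw [hz'] at h4
  exact hd.le_bot ⟨h3, h4⟩

/-- The fibers of `univIrrSet` over points of `X` are nonempty. -/
theorem univIrrSet_exists [CompactSpace X] [T2Space X] (x : X) :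
    ∃ y ∈ univIrrSet G X, ∀ E : IrreducibleExtension G X, E.π (y E) = x := by
  classical
  have hne : (𝓝 x ⊓ residual X).NeBot := by
    rw [inf_neBot_iff]
    intro s hs t ht
    obtain ⟨z, hz, hz'⟩ := (dense_of_mem_residual ht).inter_nhds_nonempty hs
    exact ⟨z, hz', hz⟩
  set p : Ultrafilter X := Ultrafilter.of (𝓝 x ⊓ residual X) with hp
  have hpx : (p : Filter X) ≤ 𝓝 x := (Ultrafilter.of_le _).trans inf_le_left
  have hpr : (p : Filter X) ≤ residual X := (Ultrafilter.of_le _).trans inf_le_right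
  let s : ∀ E : IrreducibleExtension G X, X → E.carrier := fun E =>
    Function.surjInv E.surjective_π
  have hs : ∀ (E : IrreducibleExtension G X) (z : X), E.π (s E z) = z := fun E =>
    Function.surjInv_eq E.surjective_π
  have hlim : ∀ E : IrreducibleExtension G X, ∃ y : E.carrier, Tendsto (s E) p (𝓝 y) := by
    intro E
    obtain ⟨y, -, hy⟩ := isCompact_univ.ultrafilter_le_nhds (p.map (s E)) (by simp)
    exact ⟨y, hy⟩
  choose y hy using hlim
  refine ⟨y, ?_, ?_⟩
  · intro F U hU
    have hmem : ∀ E ∈ F, fiberCore E.π (U E) ∈ (p : Filter X) := by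
      intro E hE
      have h1 : s E ⁻¹' U E ∈ (p : Filter X) := hy E ((hU E hE).1.mem_nhds (hU E hE).2)
      have ho : IsOpen (fiberCore E.π (U E)) := fiberCore_isOpen E.continuous_π (hU E hE).1
      have h2 : (frontier (fiberCore E.π (U E)))ᶜ ∈ (p : Filter X) := by
        apply hpr
        apply residual_of_dense_open isClosed_frontier.isOpen_compl
        rw [← interior_eq_empty_iff_dense_compl]
        rw [← frontier_compl]
        exact interior_frontier ho.isClosed_compl
      filter_upwards [h1, h2] with z hz hz'
      by_contra hzn
      apply hz'
      refine ⟨?_, by rwa [ho.interior_eq]⟩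
      have := image_subset_closure_fiberCore E.continuous_π E.surjective_π E.irreducible_π
        (hU E hE).1 hz
      rwa [hs] at this
    have := (Filter.biInter_finset_mem F).2 hmem
    obtain ⟨z, hz⟩ := p.neBot.nonempty_of_mem this
    exact ⟨z, by simpa using hz⟩
  · intro E
    have h1 : Tendsto (fun z => E.π (s E z)) p (𝓝 (E.π (y E))) :=
      (E.continuous_π.tendsto _).comp (hy E)
    simp only [hs] at h1
    exact tendsto_nhds_unique h1 hpx

/-- The universal irreducible extension in a large universe. -/
abbrev UnivIrrLarge : Type (max (u + 1) v) := univIrrSet G X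

instance univIrrLargeAction : MulAction G (UnivIrrLarge G X) where
  smul g y := ⟨g • y.1, univIrrSet_smul_mem g y.2⟩
  one_smul y := Subtype.ext (one_smul G y.1)
  mul_smul g h y := Subtype.ext (mul_smul g h y.1)

theorem univIrrLarge_smul_apply (g : G) (y : UnivIrrLarge G X) (E : IrreducibleExtension G X) :
    (g • y).1 E = g • y.1 E := rfl

instance univIrrLargeContinuousSMul : ContinuousSMul G (UnivIrrLarge G X) where
  continuous_smul :=
    Continuous.subtype_mk (continuous_fst.smul (continuous_subtype_val.comp continuous_snd)) _

instance univIrrLargeCompact : CompactSpace (UnivIrrLarge G X) :=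
  isCompact_iff_compactSpace.1 (univIrrSet_isClosed G X).isCompact

variable [CompactSpace X] [T2Space X] [ContinuousSMul G X]

/-- The trivial irreducible extension of `X`. -/
def IrreducibleExtension.trivial : IrreducibleExtension G X where
  carrier := X
  π := id
  continuous_π := continuous_id
  equivariant_π _ _ := rfl
  surjective_π := Function.surjective_id
  irreducible_π U _ hne := by
    obtain ⟨x, hx⟩ := hne
    exact ⟨x, by simpa using hx⟩

/-- The projection of the large model to `X`. -/
def univIrrLargeMap (y : UnivIrrLarge G X) : X := y.1 (IrreducibleExtension.trivial G X)

theorem univIrrLargeMap_eq (y : UnivIrrLarge G X) (E : IrreducibleExtension G X) :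
    E.π (y.1 E) = univIrrLargeMap G X y :=
  univIrrSet_π_eq y.2 E (IrreducibleExtension.trivial G X)

theorem univIrrLargeMap_continuous : Continuous (univIrrLargeMap G X) :=
  (continuous_apply (IrreducibleExtension.trivial G X)).comp continuous_subtype_val

theorem univIrrLargeMap_surjective : Function.Surjective (univIrrLargeMap G X) := by
  intro x
  obtain ⟨y, hy, hyx⟩ := univIrrSet_exists G X x
  exact ⟨⟨y, hy⟩, hyx (IrreducibleExtension.trivial G X)⟩

theorem univIrrLargeMap_irreducible : IsIrreducibleMap (univIrrLargeMap G X) := by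
  classical
  intro O hO hne
  obtain ⟨y, hy⟩ := hne
  obtain ⟨O', hO', rfl⟩ := isOpen_induced_iff.1 hO
  obtain ⟨F, U, hU, hsub⟩ := isOpen_pi_iff.1 hO' y.1 hy
  obtain ⟨x, hx⟩ := y.2 F U hU
  refine ⟨x, fun z hz => hsub fun E hE => hx E hE ?_⟩
  simp only [mem_preimage, mem_singleton_iff] at hz ⊢
  rw [univIrrLargeMap_eq, hz]

instance univIrrLargeSmall : Small.{u} (UnivIrrLarge G X) :=
  small_of_irreducible X (univIrrLargeMap_surjective G X) (univIrrLargeMap_irreducible G X)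

/-- The universal irreducible extension `X̂_G → X` of the `G`-flow `X`. -/
noncomputable def universalIrreducibleExtension : IrreducibleExtension G X :=
  let e : Shrink.{u} (UnivIrrLarge G X) ≃ₜ UnivIrrLarge G X := (Shrink.homeomorph _).symm
  let act : MulAction G (Shrink.{u} (UnivIrrLarge G X)) := e.toEquiv.mulAction G
  { carrier := Shrink.{u} (UnivIrrLarge G X)
    topology := inferInstance
    compact := e.symm.compactSpace
    hausdorff := e.symm.t2Space
    action := act
    continuousAction := ⟨by
      have : Continuous fun q : G × Shrink.{u} (UnivIrrLarge G X) => e.symm (q.1 • e q.2) :=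
        e.symm.continuous.comp (continuous_fst.smul (e.continuous.comp continuous_snd))
      exact this⟩
    π := fun y => univIrrLargeMap G X (e y)
    continuous_π := (univIrrLargeMap_continuous G X).comp e.continuous
    equivariant_π := fun g y => by
      have h : e (e.symm (g • e y)) = g • e y := e.apply_symm_apply _
      exact congrArg (univIrrLargeMap G X) h
    surjective_π := (univIrrLargeMap_surjective G X).comp e.surjective
    irreducible_π := fun U hU hne => by
      obtain ⟨x, hx⟩ := univIrrLargeMap_irreducible G X (e.symm ⁻¹' U)
        (hU.preimage e.symm.continuous) (hne.preimage e.symm.surjective)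
      refine ⟨x, fun y hy => ?_⟩
      have h1 : e y ∈ e.symm ⁻¹' U := hx hy
      simpa using h1 }

/-- The extension constructed above has the universal property. -/
theorem universalIrreducibleExtension_isUniversal :
    (universalIrreducibleExtension G X).IsUniversal := by
  intro F
  let e : Shrink.{u} (UnivIrrLarge G X) ≃ₜ UnivIrrLarge G X := (Shrink.homeomorph _).symm
  refine ⟨fun y => (e y).1 F, ?_, ?_, ?_⟩
  · exact (continuous_apply F).comp (continuous_subtype_val.comp e.continuous)
  · intro g y
    have h : e (e.symm (g • e y)) = g • e y := e.apply_symm_apply _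
    exact congrArg (fun z : UnivIrrLarge G X => z.1 F) h
  · intro y
    exact univIrrLargeMap_eq G X (e y) F

end Construction

/-- The underlying flow of the universal irreducible extension `X̂_G`. -/
abbrev UniversalIrreducibleFlow (G : Type v) (X : Type u) [Group G] [TopologicalSpace G]
    [TopologicalSpace X] [CompactSpace X] [T2Space X] [MulAction G X] [ContinuousSMul G X] :
    Type u :=
  (universalIrreducibleExtension G X).carrier

/-- The flow `X` is Gleason complete if `X̂_G = X`, i.e. if the extension `X̂_G → X` (a continuous
`G`-map) is an isomorphism of flows. -/
def IsGleasonComplete (G : Type v) (X : Type u) [Group G] [TopologicalSpace G]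
    [TopologicalSpace X] [CompactSpace X] [T2Space X] [MulAction G X] [ContinuousSMul G X] :
    Prop :=
  IsHomeomorph (universalIrreducibleExtension G X).π

/-! ### Stabilizers -/

/-- The stabilizer map `X → Sub(G)` into the space of closed subgroups. -/
def stabilizerMap (G : Type v) (X : Type u) [Group G] [TopologicalSpace G]
    [TopologicalSpace X] [T1Space X] [MulAction G X] [ContinuousSMul G X] (x : X) :
    ClosedSubgroup G where
  toSubgroup := MulAction.stabilizer G x
  isClosed' := by
    have h : IsClosed ((fun g : G => g • x) ⁻¹' {x}) :=
      isClosed_singleton.preimage (continuous_id.smul continuous_const)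
    exact h

/-- The stabilizer flow `S_G(X) = {G_z : z ∈ X̂_G}`, as a subset of `Sub(G)`. -/
def stabilizerFlow (G : Type v) (X : Type u) [Group G] [TopologicalSpace G]
    [TopologicalSpace X] [CompactSpace X] [T2Space X] [MulAction G X] [ContinuousSMul G X] :
    Set (ClosedSubgroup G) :=
  range (stabilizerMap G (UniversalIrreducibleFlow G X))

/-- The trivial subgroup, as a closed subgroup. -/
def trivialClosedSubgroup (G : Type v) [Group G] [TopologicalSpace G] [T1Space G] :
    ClosedSubgroup G where
  toSubgroup := ⊥
  isClosed' := by
    have h : IsClosed ({1} : Set G) := isClosed_singleton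
    exact h

/-! The substantial implication is from topological freeness of $X$ to freeness of $E=\hat X_G$.
Irreducibility lifts topological freeness to $E$. Suppose $gx=x$ in $E$ with $g\ne 1$, and take a
small symmetric neighborhood $N$ of $1$ and a compact set $D$ avoiding $1$ and containing $NNgN$.

`IsTopologicallyFreeFlow.exists_finite_coloring` gives finitely many open sets $O_k$, each moved off
itself by $D$, whose $N$-neighborhoods have dense union. So $x$ is in the closure of one of these
neighborhoods, $A$, and, being fixed by $g$, also in the closure of $gA$. But $NA$ misses $gA$,
because $O_k$ is moved off itself by $D$. The contradiction comes from
`IrreducibleExtension.IsUniversal.disjoint_closure`, the analogue for flows of extremal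
disconnectedness: in $E$ such $A$ and $gA$ have disjoint closures.

For that lemma, $A$ and $B$ with $NA\cap B=\emptyset$ are separated by a lower semicontinuous
function that is uniformly continuous along orbits. Its values on $A$ and $B$ are realized by a
continuous function on an irreducible extension of $E$ (the essential graph), and universality makes
that extension split.

The converse is easier: freeness of $E$ implies topological freeness of $E$, which descends to $X$.
Condition 3 is pointwise triviality of stabilizers. -/

/-! ### Coloring of topologically free flows -/

section Coloring

/-- Systems of open sets indexed by `ι`, each moved off itself by `C`, and any two of which are
not connected by elements of `N`. -/
def displacedSystems {G : Type*} (X : Type*) [Group G] [TopologicalSpace X] [MulAction G X] (ι : Type*) (C N : Set G) :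
    Set (Set (ι × X)) :=
  {S | (∀ k, IsOpen {x | (k, x) ∈ S}) ∧ ∀ p ∈ S, ∀ q ∈ S,
    (p.1 = q.1 → ∀ c ∈ C, c • p.2 ≠ q.2) ∧ (p.1 ≠ q.1 → ∀ n ∈ N, n • p.2 ≠ q.2)}

/-- Zorn's lemma applies because openness survives unions and the other conditions involve only two
points at a time. -/
theorem exists_maximal_displacedSystems {G X : Type*} [Group G] [TopologicalSpace X] [MulAction G X]
    (ι : Type*) (C N : Set G) :
    ∃ S, Maximal (· ∈ displacedSystems X ι C N) S := by
  refine zorn_subset _ fun c hc hchain => ⟨⋃₀ c, ⟨fun k => ?_, ?_⟩, fun s hs =>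
    subset_sUnion_of_mem hs⟩
  · have : {x | (k, x) ∈ ⋃₀ c} = ⋃ s ∈ c, {x | (k, x) ∈ s} := by
      ext x; simp
    rw [this]
    exact isOpen_biUnion fun s hs => (hc hs).1 k
  · rintro p ⟨s, hs, hp⟩ q ⟨t, ht, hq⟩
    obtain hst | hts := hchain.total hs ht
    · exact (hc ht).2 p (hst hp) q hq
    · exact (hc hs).2 p hp q (hts hq)

variable {G : Type v} {X : Type u} [Group G] [TopologicalSpace G] [TopologicalSpace X]
  [MulAction G X] [ContinuousSMul G X]

/-- In a topologically free flow, every nonempty open set contains a nonempty open set which is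
moved off itself by all elements of a given compact set avoiding the identity. -/
theorem IsTopologicallyFreeFlow.exists_open_displaced [T2Space X]
    (h : IsTopologicallyFreeFlow G X) {C : Set G} (hC : IsCompact C) (h1 : (1 : G) ∉ C)
    {W : Set X} (hW : IsOpen W) (hne : W.Nonempty) :
    ∃ U ⊆ W, IsOpen U ∧ U.Nonempty ∧ ∀ c ∈ C, ∀ x ∈ U, c • x ∉ U := by
  obtain ⟨x, hxW, hx⟩ : ∃ x ∈ W, ∀ c ∈ C, c • x ≠ x := by
    by_contra! hcon
    obtain ⟨w, hw⟩ := hne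
    have : w ∈ interior {x : X | ∃ k ∈ C, k • x = x} :=
      mem_interior.2 ⟨W, fun z hz => hcon z hz, hW, hw⟩
    rw [h C hC h1] at this
    exact this
  have hev : ∀ᶠ p : X × X in 𝓝 (x, x), ∀ c ∈ C, c • p.1 ≠ p.2 := by
    refine hC.eventually_forall_of_forall_eventually fun c hc => ?_
    have hcont : ContinuousAt (fun q : (X × X) × G => (q.2 • q.1.1, q.1.2)) ((x, x), c) := by
      fun_prop
    exact hcont.eventually (isClosed_diagonal.isOpen_compl.mem_nhds
      (show (c • x, x) ∈ (diagonal X)ᶜ from hx c hc))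
  rw [nhds_prod_eq, eventually_prod_self_iff'] at hev
  obtain ⟨S, hS, hSC⟩ := hev
  obtain ⟨U, hUS, hU, hxU⟩ := mem_nhds_iff.1 hS
  exact ⟨U ∩ W, inter_subset_right, hU.inter hW, ⟨x, hxU, hxW⟩, fun c hc z hz hcz =>
    hSC z (hUS hz.1) (c • z) (hUS hcz.1) c hc rfl⟩

/-- A topologically free flow has a dense subset covered by the `N`-neighborhoods of finitely many
open sets, each moved off itself by all elements of the compact set `C`. -/
theorem IsTopologicallyFreeFlow.exists_finite_coloring [IsTopologicalGroup G] [T2Space X]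
    (h : IsTopologicallyFreeFlow G X) {C N : Set G} (hC : IsCompact C) (h1 : (1 : G) ∉ C)
    (hCinv : ∀ c ∈ C, c⁻¹ ∈ C) (hN : N ∈ 𝓝 (1 : G)) (hNinv : ∀ n ∈ N, n⁻¹ ∈ N) :
    ∃ (m : ℕ) (O : Fin m → Set X), (∀ k, IsOpen (O k)) ∧
      (∀ k, ∀ c ∈ C, ∀ x ∈ O k, c • x ∉ O k) ∧
      Dense (⋃ k, {y | ∃ n ∈ N, ∃ x ∈ O k, n • x = y}) := by
  classical
  -- With $C$ covered by finitely many translates $tW$, $t\in T$, two elements of $C$ in the same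
  -- translate satisfy $c^{-1}c'\in N$.
  obtain ⟨W, hW, hWN⟩ : ∃ W ∈ 𝓝 (1 : G), ∀ a ∈ W, ∀ b ∈ W, a⁻¹ * b ∈ N := by
    have hcont : ContinuousAt (fun p : G × G => p.1⁻¹ * p.2) (1, 1) := by fun_prop
    have hev : ∀ᶠ p : G × G in 𝓝 (1, 1), p.1⁻¹ * p.2 ∈ N :=
      hcont.eventually_mem (by simpa using hN)
    rw [nhds_prod_eq, eventually_prod_self_iff'] at hev
    exact hev
  obtain ⟨T, -, hT⟩ := hC.elim_nhds_subcover (fun t => (fun a => t⁻¹ * a) ⁻¹' W) fun t _ => by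
    have hcont : ContinuousAt (fun a : G => t⁻¹ * a) t := by fun_prop
    exact hcont.preimage_mem_nhds (by simpa using hW)
  -- One color more than there are translates, for the final pigeonhole.
  obtain ⟨S, hS, hmax⟩ := exists_maximal_displacedSystems (X := X) (Fin (T.card + 1)) C N
  refine ⟨T.card + 1, fun k => {x | (k, x) ∈ S}, hS.1,
    fun k c hc x hx hcx => (hS.2 _ hx _ hcx).1 rfl c hc rfl, ?_⟩
  rw [dense_iff_inter_open]
  intro U₀ hU₀ hU₀ne
  by_contra hcon
  obtain ⟨U, hUU₀, hU, hUne, hUC⟩ := h.exists_open_displaced hC h1 hU₀ hU₀ne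
  have hfar : ∀ k x, (k, x) ∈ S → ∀ n ∈ N, n • x ∉ U := fun k x hx n hn hnx =>
    hcon ⟨n • x, hUU₀ hnx, mem_iUnion.2 ⟨k, n, hn, x, hx, rfl⟩⟩
  have hfar' : ∀ k x, (k, x) ∈ S → ∀ n ∈ N, ∀ y ∈ U, n • y ≠ x := fun k x hx n hn y hy hxy =>
    hfar k x hx n⁻¹ (hNinv n hn) (by rwa [← hxy, inv_smul_smul])
  -- Adding $U'$ to color $k$ would contradict maximality, as $U$ is moved off itself by $C$ and is
  -- $N$-far from all colors. The only possible obstruction is some $c\in C$ carrying a point of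
  -- color $k$ into $U'$.
  have hmeet : ∀ k, ∀ U' ⊆ U, IsOpen U' → U'.Nonempty →
      ∃ c ∈ C, ∃ y ∈ U', (k, c⁻¹ • y) ∈ S := by
    intro k U' hU'U hU' hne
    by_contra! hno
    have hno' : ∀ c ∈ C, ∀ x, (k, x) ∈ S → c • x ∉ U' := fun c hc x hx hcx =>
      hno c hc _ hcx (by rwa [inv_smul_smul])
    have hmem : S ∪ {p | p.1 = k ∧ p.2 ∈ U'} ∈ displacedSystems X (Fin (T.card + 1)) C N := by
      refine ⟨fun l => ?_, ?_⟩
      · by_cases hl : l = k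
        · subst hl
          have : {x | (l, x) ∈ S ∪ {p | p.1 = l ∧ p.2 ∈ U'}} = {x | (l, x) ∈ S} ∪ U' := by
            ext x; simp
          rw [this]
          exact (hS.1 l).union hU'
        · have : {x | (l, x) ∈ S ∪ {p | p.1 = k ∧ p.2 ∈ U'}} = {x | (l, x) ∈ S} := by
            ext x; simp [hl]
          rw [this]
          exact hS.1 l
      · rintro ⟨i, x⟩ (hx | ⟨rfl, hx⟩) ⟨j, y⟩ (hy | ⟨rfl, hy⟩)
        · exact hS.2 _ hx _ hy
        · refine ⟨?_, fun _ n hn hxy => ?_⟩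
          · rintro rfl c hc hxy
            exact hno' c hc x hx (hxy ▸ hy)
          · exact hfar i x hx n hn (hxy ▸ hU'U hy)
        · refine ⟨?_, fun _ n hn hxy => hfar' j y hy n hn x (hU'U hx) hxy⟩
          rintro rfl c hc hxy
          exact hno c⁻¹ (hCinv c hc) x hx (by rw [inv_inv]; exact hxy ▸ hy)
        · exact ⟨fun _ c hc hxy => hUC c hc x (hU'U hx) (hxy ▸ hU'U hy), fun hne => (hne rfl).elim⟩
    obtain ⟨y, hy⟩ := hne
    have hyS : (k, y) ∈ S := hmax hmem subset_union_left (Or.inr ⟨rfl, hy⟩)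
    exact hfar k y hyS 1 (mem_of_mem_nhds hN) (by simpa using hU'U hy)
  -- Shrinking $U$ once per color yields a single $y$ for which every color $k$ contains some
  -- $c_k^{-1}y$ with $c_k\in C$.
  have hall : ∀ F : Finset (Fin (T.card + 1)), ∃ U' ⊆ U, IsOpen U' ∧ U'.Nonempty ∧
      ∀ k ∈ F, ∃ c ∈ C, ∀ y ∈ U', (k, c⁻¹ • y) ∈ S := by
    intro F
    induction F using Finset.induction_on with
    | empty => exact ⟨U, Subset.rfl, hU, hUne, by simp⟩
    | insert k F _ ih =>
      obtain ⟨U', hU'U, hU', hne, hF⟩ := ih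
      obtain ⟨c, hc, y, hy, hyS⟩ := hmeet k U' hU'U hU' hne
      refine ⟨U' ∩ (fun y => c⁻¹ • y) ⁻¹' {x | (k, x) ∈ S}, inter_subset_left.trans hU'U,
        hU'.inter ((hS.1 k).preimage (continuous_const_smul _)), ⟨y, hy, hyS⟩, fun l hl => ?_⟩
      rcases Finset.mem_insert.1 hl with rfl | hl
      · exact ⟨c, hc, fun z hz => hz.2⟩
      · obtain ⟨d, hd, hdS⟩ := hF l hl
        exact ⟨d, hd, fun z hz => hdS z hz.1⟩
  obtain ⟨U', -, -, ⟨y, hy⟩, hF⟩ := hall Finset.univ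
  choose c hc hcS using fun k => hF k (Finset.mem_univ k)
  have ht : ∀ k, ∃ t ∈ T, t⁻¹ * c k ∈ W := fun k => by simpa using hT (hc k)
  choose t htT htW using ht
  obtain ⟨k, -, l, -, hkl, htkl⟩ := Finset.exists_ne_map_eq_of_card_lt_of_maps_to
    (s := (Finset.univ : Finset (Fin (T.card + 1)))) (t := T) (by simp) (f := t)
    fun k _ => htT k
  have hn : (c k)⁻¹ * c l ∈ N := by
    have := hWN _ (htW k) _ (htW l)
    rw [← htkl] at this
    convert this using 1
    group
  -- The element $c_k^{-1}c_l\in N$ carries $c_l^{-1}y$ to $c_k^{-1}y$, connecting two different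
  -- colors.
  refine (hS.2 _ (hcS l y hy) _ (hcS k y hy)).2 (Ne.symm hkl) _ hn ?_
  simp [smul_smul]

end Coloring

/-! ### Extending semicontinuous functions to irreducible extensions -/

/-- Transport of an irreducible extension in an arbitrary universe to the universe of the base:
every such extension is the pullback of a bundled one along a homeomorphism. -/
theorem exists_irreducibleExtension_homeomorph {G : Type v} {X : Type u} [Group G]
    [TopologicalSpace G] [TopologicalSpace X] [MulAction G X] (Y : Type*) [TopologicalSpace Y]
    [CompactSpace Y] [T2Space Y] [MulAction G Y] [ContinuousSMul G Y] {π : Y → X}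
    (hc : Continuous π) (he : ∀ (g : G) (y : Y), π (g • y) = g • π y)
    (hs : Function.Surjective π) (hi : IsIrreducibleMap π) :
    ∃ (F : IrreducibleExtension G X) (e : F.carrier ≃ₜ Y), ∀ y, π (e y) = F.π y := by
  have : Small.{u} Y := small_of_irreducible X hs hi
  let e : Shrink.{u} Y ≃ₜ Y := (Shrink.homeomorph _).symm
  let act : MulAction G (Shrink.{u} Y) := e.toEquiv.mulAction G
  refine ⟨{ carrier := Shrink.{u} Y
            topology := inferInstance
            compact := e.symm.compactSpace
            hausdorff := e.symm.t2Space
            action := act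
            continuousAction := ⟨?_⟩
            π := fun y => π (e y)
            continuous_π := hc.comp e.continuous
            equivariant_π := fun g y => ?_
            surjective_π := hs.comp e.surjective
            irreducible_π := fun U hU hne => ?_ }, e, fun _ => rfl⟩
  · have : Continuous fun q : G × Shrink.{u} Y => e.symm (q.1 • e q.2) :=
      e.symm.continuous.comp (continuous_fst.smul (e.continuous.comp continuous_snd))
    exact this
  · have h : e (e.symm (g • e y)) = g • e y := e.apply_symm_apply _
    exact (congrArg π h).trans (he g _)
  · obtain ⟨x, hx⟩ := hi (e.symm ⁻¹' U) (hU.preimage e.symm.continuous)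
      (hne.preimage e.symm.surjective)
    refine ⟨x, fun y hy => ?_⟩
    have h1 : e y ∈ e.symm ⁻¹' U := hx hy
    simpa using h1

/-- A lower semicontinuous function to the unit interval has small oscillation on some open subset
of any given nonempty open set. -/
theorem LowerSemicontinuous.exists_open_dist_lt {X : Type*} [TopologicalSpace X]
    {f : X → unitInterval} (hf : LowerSemicontinuous f) {W : Set X} (hW : IsOpen W)
    (hne : W.Nonempty) {ε : ℝ} (hε : 0 < ε) :
    ∃ U ⊆ W, IsOpen U ∧ U.Nonempty ∧ ∀ u ∈ U, ∀ v ∈ U, dist (f u) (f v) < ε := by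
  have hbdd : BddAbove ((fun x => (f x : ℝ)) '' W) :=
    ⟨1, by rintro _ ⟨x, -, rfl⟩; exact (f x).2.2⟩
  -- The part of $W$ where $f$ exceeds its supremum minus $ε$ is open, by semicontinuity.
  obtain ⟨_, ⟨w, hw, rfl⟩, hlt⟩ := exists_lt_of_lt_csSup (hne.image fun x => (f x : ℝ))
    (sub_lt_self (sSup ((fun x => (f x : ℝ)) '' W)) hε)
  have hle : ∀ x ∈ W, (f x : ℝ) ≤ sSup ((fun x => (f x : ℝ)) '' W) := fun x hx =>
    le_csSup hbdd ⟨x, hx, rfl⟩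
  have hcoe : LowerSemicontinuous fun x => (f x : ℝ) :=
    continuous_subtype_val.comp_lowerSemicontinuous hf (Subtype.mono_coe _)
  refine ⟨W ∩ (fun x => (f x : ℝ)) ⁻¹' Ioi (sSup ((fun x => (f x : ℝ)) '' W) - ε),
    inter_subset_left, hW.inter (lowerSemicontinuous_iff_isOpen_preimage.1 hcoe _),
    ⟨w, hw, hlt⟩, fun u hu v hv => ?_⟩
  have h1 : _ < (f u : ℝ) := hu.2
  have h2 : _ < (f v : ℝ) := hv.2
  have h3 := hle u hu.1
  have h4 := hle v hv.1
  rw [Subtype.dist_eq, Real.dist_eq, abs_lt]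
  constructor <;> linarith

/-! ### Essential limits of orbit functions -/

section EssentialGraph

theorem eventually_forall_finset_dist_lt {G : Type*} (φ : G → unitInterval) (F : Finset G) {ε : ℝ}
    (hε : 0 < ε) : ∀ᶠ ψ in 𝓝 φ, ∀ h ∈ F, dist (ψ h) (φ h) < ε := by
  rw [Filter.eventually_all_finset]
  exact fun h _ => Metric.tendsto_nhds.1 ((continuous_apply h).tendsto φ) ε hε

variable {G : Type v} {X : Type u} [Group G] [TopologicalSpace X] [MulAction G X]

/-- The set of pairs `(x, φ)` such that the orbit functions `h ↦ f (h • u)` approximate `φ` for all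
`u` in suitable nonempty open sets arbitrarily near `x`. -/
def essentialGraph (G : Type v) {X : Type u} [Group G] [TopologicalSpace X] [MulAction G X]
    (f : X → unitInterval) : Set (X × (G → unitInterval)) :=
  {q | ∀ W ∈ 𝓝 q.1, ∀ (F : Finset G) (ε : ℝ), 0 < ε → ∃ U ⊆ W, IsOpen U ∧ U.Nonempty ∧
    ∀ u ∈ U, ∀ h ∈ F, dist (f (h • u)) (q.2 h) < ε}

theorem isClosed_essentialGraph (f : X → unitInterval) : IsClosed (essentialGraph G f) := by
  rw [← closure_subset_iff_isClosed]
  intro q hq W hW F ε hε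
  obtain ⟨W', hW'W, hW', hqW'⟩ := mem_nhds_iff.1 hW
  have hev : ∀ᶠ r in 𝓝 q, r.1 ∈ W' ∧ ∀ h ∈ F, dist (r.2 h) (q.2 h) < ε / 2 :=
    (continuous_fst.continuousAt.eventually (hW'.mem_nhds hqW')).and
      (continuous_snd.continuousAt.eventually
        (eventually_forall_finset_dist_lt q.2 F (half_pos hε)))
  obtain ⟨r, ⟨hrW, hrF⟩, hr⟩ := mem_closure_iff_nhds.1 hq _ hev
  obtain ⟨U, hUW, hU, hne, hUF⟩ := hr W' (hW'.mem_nhds hrW) F (ε / 2) (half_pos hε)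
  refine ⟨U, hUW.trans hW'W, hU, hne, fun u hu h hh => ?_⟩
  linarith [dist_triangle (f (h • u)) (r.2 h) (q.2 h), hUF u hu h hh, hrF h hh]

/-- The value $φ(h)$ is a limit of values $f(hu)$ with $u$ near $x$, so closed bounds valid near $x$
pass to it. -/
theorem dist_le_of_mem_essentialGraph {f : X → unitInterval} {q : X × (G → unitInterval)}
    (hq : q ∈ essentialGraph G f) {W : Set X} (hW : W ∈ 𝓝 q.1) (h : G) {c : unitInterval} {δ : ℝ}
    (hWc : ∀ u ∈ W, dist (f (h • u)) c ≤ δ) : dist (q.2 h) c ≤ δ := by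
  refine le_of_forall_pos_le_add fun ε hε => ?_
  obtain ⟨U, hUW, -, ⟨u, hu⟩, hUF⟩ := hq W hW {h} ε hε
  have h1 := hUF u hu h (Finset.mem_singleton_self h)
  rw [dist_comm] at h1
  linarith [dist_triangle (q.2 h) (f (h • u)) c, hWc u (hUW hu)]

theorem eq_of_mem_essentialGraph {f : X → unitInterval} {q : X × (G → unitInterval)}
    (hq : q ∈ essentialGraph G f) {W : Set X} (hW : W ∈ 𝓝 q.1) {c : unitInterval}
    (hWc : ∀ u ∈ W, f u = c) : q.2 1 = c := by
  rw [← dist_le_zero]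
  exact dist_le_of_mem_essentialGraph hq hW 1 fun u hu => by simp [hWc u hu]

theorem dist_apply_mul_le_of_mem_essentialGraph {f : X → unitInterval}
    {q : X × (G → unitInterval)} (hq : q ∈ essentialGraph G f) {k : G} {δ : ℝ}
    (hk : ∀ x, dist (f (k • x)) (f x) ≤ δ) (h : G) : dist (q.2 (k * h)) (q.2 h) ≤ δ := by
  refine le_of_forall_pos_le_add fun ε hε => ?_
  classical
  obtain ⟨U, -, -, ⟨u, hu⟩, hUF⟩ := hq univ univ_mem {k * h, h} (ε / 2) (half_pos hε)
  have h1 := hUF u hu (k * h) (by simp)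
  have h2 := hUF u hu h (by simp)
  have h3 := hk (h • u)
  rw [smul_smul] at h3
  rw [dist_comm] at h1
  linarith [dist_triangle4 (q.2 (k * h)) (f ((k * h) • u)) (f (h • u)) (q.2 h)]

/-- The projection of the essential graph to the base is irreducible. -/
theorem isIrreducibleMap_essentialGraph (f : X → unitInterval) :
    IsIrreducibleMap fun q : essentialGraph G f => q.1.1 := by
  rintro O hO ⟨q, hqO⟩
  obtain ⟨O', hO', rfl⟩ := isOpen_induced_iff.1 hO
  have hmem : O' ∈ 𝓝 (q.1.1, q.1.2) := hO'.mem_nhds hqO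
  rw [nhds_prod_eq, mem_prod_iff] at hmem
  obtain ⟨W, hW, B, hB, hWB⟩ := hmem
  obtain ⟨F, ε, hε, hFB⟩ : ∃ (F : Finset G) (ε : ℝ), 0 < ε ∧
      ∀ ψ : G → unitInterval, (∀ h ∈ F, dist (ψ h) (q.1.2 h) < ε) → ψ ∈ B := by
    obtain ⟨B', hB'B, hB', hqB'⟩ := mem_nhds_iff.1 hB
    obtain ⟨F, V, hV, hVB⟩ := isOpen_pi_iff.1 hB' _ hqB'
    have hev : ∀ᶠ ε : ℝ in 𝓝[>] 0, ∀ h ∈ F, Metric.ball (q.1.2 h) ε ⊆ V h := by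
      rw [Filter.eventually_all_finset]
      intro h hh
      obtain ⟨ε, hε, hεV⟩ := Metric.isOpen_iff.1 (hV h hh).1 _ (hV h hh).2
      filter_upwards [Ioo_mem_nhdsGT hε] with δ hδ
      exact (Metric.ball_subset_ball hδ.2.le).trans hεV
    obtain ⟨ε, hεF, hε⟩ := (hev.and self_mem_nhdsWithin).exists
    exact ⟨F, ε, hε, fun ψ hψ => hB'B (hVB fun h hh => hεF h hh (hψ h hh))⟩
  -- On $U$ the orbit functions are within $ε/2$ of $φ$ on $F$, so everything in the fiber over a
  -- point of $U$ is within $ε/2$ too; the whole fiber lies in the given neighborhood.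
  obtain ⟨U, hUW, hU, ⟨u, hu⟩, hUF⟩ := q.2 W hW F (ε / 2) (half_pos hε)
  refine ⟨u, fun r hr => ?_⟩
  have hru : r.1.1 = u := hr
  refine hWB (mk_mem_prod (by rw [hru]; exact hUW hu) (hFB _ fun h hh => ?_))
  have := dist_le_of_mem_essentialGraph r.2 (hU.mem_nhds (by rwa [hru])) h
    fun v hv => (hUF v hv h hh).le
  linarith

/-- The orbit function of $gx$ is $h\mapsto f(hgx)$, which dictates the right translation. Recording
whole orbit functions, not just values of $f$, is what makes the graph a flow. -/
theorem smul_mem_essentialGraph [ContinuousConstSMul G X] {f : X → unitInterval} (g : G)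
    {q : X × (G → unitInterval)} (hq : q ∈ essentialGraph G f) :
    (g • q.1, fun h => q.2 (h * g)) ∈ essentialGraph G f := by
  classical
  intro W hW F ε hε
  obtain ⟨U, hUW, hU, ⟨u, hu⟩, hUF⟩ := hq ((fun x => g • x) ⁻¹' W)
    ((continuous_const_smul g).continuousAt.preimage_mem_nhds hW) (F.image (· * g)) ε hε
  refine ⟨(fun x => g⁻¹ • x) ⁻¹' U, fun x hx => ?_, hU.preimage (continuous_const_smul _),
    ⟨g • u, by simpa using hu⟩, fun x hx h hh => ?_⟩
  · simpa using hUW hx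
  · simpa [smul_smul] using hUF _ hx (h * g) (Finset.mem_image_of_mem _ hh)

instance essentialGraphMulAction [ContinuousConstSMul G X] (f : X → unitInterval) :
    MulAction G (essentialGraph G f) where
  smul g q := ⟨_, smul_mem_essentialGraph g q.2⟩
  one_smul q := Subtype.ext (Prod.ext (one_smul G _) (funext fun h => congrArg q.1.2 (mul_one h)))
  mul_smul g g' q := Subtype.ext (Prod.ext (mul_smul g g' _)
    (funext fun h => congrArg q.1.2 (mul_assoc h g g').symm))

/-- The product topology ignores the topology of $G$; joint continuity comes from the modulus of
continuity of $f$ along orbits, which every $φ$ in the graph inherits. -/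
theorem continuousSMul_essentialGraph [TopologicalSpace G] [IsTopologicalGroup G]
    [ContinuousSMul G X] {f : X → unitInterval}
    (hf : ∀ ε > 0, ∀ᶠ k in 𝓝 (1 : G), ∀ x, dist (f (k • x)) (f x) ≤ ε) :
    ContinuousSMul G (essentialGraph G f) := by
  refine ⟨Continuous.subtype_mk (Continuous.prodMk ?_ (continuous_pi fun h => ?_)) _⟩
  · exact continuous_fst.smul (continuous_fst.comp (continuous_subtype_val.comp continuous_snd))
  · rw [continuous_iff_continuousAt]
    rintro ⟨g, q⟩
    rw [ContinuousAt, Metric.tendsto_nhds]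
    intro ε hε
    have hk : ContinuousAt (fun p : G × essentialGraph G f => h * p.1 * g⁻¹ * h⁻¹) (g, q) := by
      fun_prop
    have h1 : ∀ᶠ p : G × essentialGraph G f in 𝓝 (g, q),
        ∀ x, dist (f ((h * p.1 * g⁻¹ * h⁻¹) • x)) (f x) ≤ ε / 2 :=
      hk.eventually (by simpa using hf (ε / 2) (half_pos hε))
    have hq : Continuous fun p : G × essentialGraph G f => p.2.1.2 (h * g) :=
      (continuous_apply (h * g)).comp
        (continuous_snd.comp (continuous_subtype_val.comp continuous_snd))
    have h2 := (Metric.tendsto_nhds.1 (hq.tendsto (g, q))) (ε / 2) (half_pos hε)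
    filter_upwards [h1, h2] with p hp1 hp2
    have h3 := dist_apply_mul_le_of_mem_essentialGraph p.2.2 hp1 (h * g)
    have h4 : h * p.1 * g⁻¹ * h⁻¹ * (h * g) = h * p.1 := by group
    rw [h4] at h3
    exact (dist_triangle _ _ _).trans_lt (by linarith)

/-- Take $φ$ to be the limit of orbit functions along an ultrafilter converging to $x$ and
containing every comeager set. Near generic points finitely many translates of $f$ oscillate little,
so closeness to $φ$ at one point spreads to an open set. -/
theorem exists_mem_essentialGraph [CompactSpace X] [T2Space X] [ContinuousConstSMul G X]
    {f : X → unitInterval} (hf : LowerSemicontinuous f) (x : X) :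
    ∃ φ : G → unitInterval, (x, φ) ∈ essentialGraph G f := by
  classical
  have hosc : ∀ (F : Finset G) (ε : ℝ), 0 < ε → ∀ W : Set X, IsOpen W → W.Nonempty →
      ∃ U ⊆ W, IsOpen U ∧ U.Nonempty ∧
        ∀ h ∈ F, ∀ u ∈ U, ∀ v ∈ U, dist (f (h • u)) (f (h • v)) < ε := by
    intro F ε hε W hW hne
    induction F using Finset.induction_on with
    | empty => exact ⟨W, Subset.rfl, hW, hne, by simp⟩
    | insert h F _ ih =>
      obtain ⟨U, hUW, hU, hUne, hF⟩ := ih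
      obtain ⟨U', hU'U, hU', hne', hd⟩ :=
        (hf.comp (continuous_const_smul h)).exists_open_dist_lt hU hUne hε
      refine ⟨U', hU'U.trans hUW, hU', hne', fun k hk u hu v hv => ?_⟩
      rcases Finset.mem_insert.1 hk with rfl | hk
      · exact hd u hu v hv
      · exact hF k hk u (hU'U hu) v (hU'U hv)
  have hne : (𝓝 x ⊓ residual X).NeBot := by
    rw [inf_neBot_iff]
    intro s hs t ht
    obtain ⟨z, hz, hz'⟩ := (dense_of_mem_residual ht).inter_nhds_nonempty hs
    exact ⟨z, hz', hz⟩
  set p : Ultrafilter X := Ultrafilter.of (𝓝 x ⊓ residual X)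
  have hpx : (p : Filter X) ≤ 𝓝 x := (Ultrafilter.of_le _).trans inf_le_left
  have hpr : (p : Filter X) ≤ residual X := (Ultrafilter.of_le _).trans inf_le_right
  have hlim : ∀ h : G, ∃ c : unitInterval, Tendsto (fun u => f (h • u)) p (𝓝 c) := by
    intro h
    obtain ⟨c, -, hc⟩ := isCompact_univ.ultrafilter_le_nhds (p.map fun u => f (h • u)) (by simp)
    exact ⟨c, hc⟩
  choose φ hφ using hlim
  refine ⟨φ, fun W hW F ε hε => ?_⟩
  obtain ⟨W', hW'W, hW', hxW'⟩ := mem_nhds_iff.1 hW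
  let D : Set X := ⋃₀ {U | IsOpen U ∧
    ∀ h ∈ F, ∀ u ∈ U, ∀ v ∈ U, dist (f (h • u)) (f (h • v)) < ε / 2}
  have hD : D ∈ residual X := by
    refine residual_of_dense_open (isOpen_sUnion fun U hU => hU.1) ?_
    rw [dense_iff_inter_open]
    intro V hV hVne
    obtain ⟨U, hUV, hU, ⟨u, hu⟩, hUF⟩ := hosc F (ε / 2) (half_pos hε) V hV hVne
    exact ⟨u, hUV hu, U, ⟨hU, hUF⟩, hu⟩
  have hclose : ∀ᶠ u in (p : Filter X), ∀ h ∈ F, dist (f (h • u)) (φ h) < ε / 2 := by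
    rw [Filter.eventually_all_finset]
    exact fun h _ => Metric.tendsto_nhds.1 (hφ h) _ (half_pos hε)
  obtain ⟨u, ⟨⟨U, ⟨hU, hUF⟩, huU⟩, huW⟩, hu⟩ :=
    ((Filter.eventually_mem_set.2 (hpr hD)).and
      (Filter.eventually_mem_set.2 (hpx (hW'.mem_nhds hxW'))) |>.and hclose).exists
  refine ⟨U ∩ W', inter_subset_right.trans hW'W, hU.inter hW', ⟨u, huU, huW⟩, fun v hv h hh => ?_⟩
  linarith [dist_triangle (f (h • v)) (f (h • u)) (φ h), hUF h hh v hv.1 u huU, hu h hh]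

end EssentialGraph

/-- A lower semicontinuous function which is uniformly continuous along orbits extends to a
continuous function on some irreducible extension. -/
theorem exists_irreducibleExtension_of_lowerSemicontinuous {G : Type v} {X : Type u} [Group G]
    [TopologicalSpace G] [IsTopologicalGroup G] [TopologicalSpace X] [CompactSpace X] [T2Space X]
    [MulAction G X] [ContinuousSMul G X] {f : X → unitInterval} (hlsc : LowerSemicontinuous f)
    (hf : ∀ ε > 0, ∀ᶠ k in 𝓝 (1 : G), ∀ x, dist (f (k • x)) (f x) ≤ ε) :
    ∃ (F : IrreducibleExtension G X) (Φ : F.carrier → unitInterval), Continuous Φ ∧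
      ∀ (U : Set X) (c : unitInterval), IsOpen U → (∀ u ∈ U, f u = c) →
        ∀ y, F.π y ∈ U → Φ y = c := by
  have := continuousSMul_essentialGraph hf
  have : CompactSpace (essentialGraph G f) :=
    isCompact_iff_compactSpace.1 (isClosed_essentialGraph f).isCompact
  -- The essential graph involves the universe of $G$, so it must be moved back to that of $X$.
  obtain ⟨F, e, he⟩ := exists_irreducibleExtension_homeomorph (G := G) (X := X)
    (essentialGraph G f) (π := fun q => q.1.1) (continuous_fst.comp continuous_subtype_val)
    (fun _ _ => rfl)
    (fun x => (exists_mem_essentialGraph hlsc x).elim fun φ hφ => ⟨⟨(x, φ), hφ⟩, rfl⟩)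
    (isIrreducibleMap_essentialGraph f)
  refine ⟨F, fun y => (e y).1.2 1, (continuous_apply 1).comp
    (continuous_snd.comp (continuous_subtype_val.comp e.continuous)), ?_⟩
  intro U c hU hUc y hy
  rw [← he] at hy
  exact eq_of_mem_essentialGraph (e y).2 (hU.mem_nhds hy) hUc

/-! ### Disjoint closures in the universal irreducible extension -/

section Thickening

variable {G : Type v} {X : Type u} [Group G] [TopologicalSpace G] [IsTopologicalGroup G]
  [TopologicalSpace X] [MulAction G X] [ContinuousSMul G X]

/-- A continuous function with compact support on a group is uniformly continuous with respect to
left translations. -/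
theorem eventually_forall_dist_mul_le {ψ : G → ℝ} (hψ : Continuous ψ) (hs : HasCompactSupport ψ)
    {ε : ℝ} (hε : 0 < ε) : ∀ᶠ k in 𝓝 (1 : G), ∀ h, |ψ (k * h) - ψ h| ≤ ε := by
  -- In this uniformity the closeness of $h$ and $kh$ depends on $k$ alone, since $(kh)h^{-1}=k$.
  let := IsTopologicalGroup.rightUniformSpace G
  have huc : UniformContinuous ψ := hs.uniformContinuous_of_continuous hψ
  have h1 := huc (Metric.dist_mem_uniformity hε)
  rw [mem_map, uniformity_eq_comap_nhds_one' G, mem_comap] at h1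
  obtain ⟨S, hS, hSψ⟩ := h1
  filter_upwards [hS] with k hk h
  have h2 : (h, k * h) ∈ (fun p : G × G => p.2 * p.1⁻¹) ⁻¹' S := by simpa using hk
  have h3 : dist (ψ h) (ψ (k * h)) < ε := hSψ h2
  rw [dist_comm, Real.dist_eq] at h3
  exact h3.le

/-- If the `N`-neighborhood of an open set `A` misses `B`, then `A` and `B` are separated by a lower
semicontinuous function which is uniformly continuous along orbits. -/
theorem exists_lowerSemicontinuous_of_smul_disjoint [LocallyCompactSpace G] [T2Space G] {N : Set G}
    (hN : N ∈ 𝓝 (1 : G)) {A B : Set X} (hA : IsOpen A)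
    (hAB : ∀ n ∈ N, ∀ x ∈ A, n • x ∉ B) :
    ∃ f : X → unitInterval, LowerSemicontinuous f ∧
      (∀ ε > 0, ∀ᶠ k in 𝓝 (1 : G), ∀ x, dist (f (k • x)) (f x) ≤ ε) ∧
      (∀ x ∈ A, f x = 1) ∧ ∀ x ∈ B, f x = 0 := by
  obtain ⟨ψ, hψ1, hψ0, hψs, hψI⟩ := exists_continuous_one_zero_of_isCompact
    (isCompact_singleton (x := (1 : G))) (isOpen_interior (s := N)).isClosed_compl
    (by simpa [disjoint_left] using mem_interior_iff_mem_nhds.2 hN)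
  have hψN : ∀ h, h ∉ N → ψ h = 0 := fun h hh => hψ0 fun hh' => hh (interior_subset hh')
  let ψ' : G → unitInterval := fun h => ⟨ψ h, hψI h⟩
  -- The indicator of $A$ is spread along orbits by the bump $ψ$, supported in $N$. An empty
  -- supremum is $0$, so $f$ vanishes off $NA$.
  let f : X → unitInterval := fun x => ⨆ h, ⨆ _ : h⁻¹ • x ∈ A, ψ' h
  have hlt : ∀ x r, r < f x ↔ ∃ h, h⁻¹ • x ∈ A ∧ r < ψ' h := fun x r => by
    simp only [f, lt_iSup_iff, exists_prop]
  have hge : ∀ x h, h⁻¹ • x ∈ A → ψ' h ≤ f x := fun x h hh => le_iSup₂_of_le h hh le_rfl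
  -- Replacing $x$ by $kx$ amounts to substituting $k^{-1}h$ for $h$ in the supremum.
  have hshift : ∀ (ε : ℝ), 0 ≤ ε → ∀ k, (∀ h, ψ h ≤ ψ (k⁻¹ * h) + ε) →
      ∀ x, (f (k • x) : ℝ) ≤ f x + ε := by
    intro ε hε k hk x
    by_contra! hcon
    obtain ⟨h, hhA, hh⟩ := (hlt (k • x)
      ⟨f x + ε, add_nonneg (f x).2.1 hε, hcon.le.trans (f (k • x)).2.2⟩).1 hcon
    have h1 : ψ (k⁻¹ * h) ≤ f x := hge x (k⁻¹ * h) (by simpa [mul_smul] using hhA)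
    have h2 : (f x : ℝ) + ε < ψ h := hh
    linarith [hk h]
  refine ⟨f, ?_, fun ε hε => ?_, fun x hx => ?_, fun x hx => ?_⟩
  · rw [lowerSemicontinuous_iff_isOpen_preimage]
    intro r
    have : f ⁻¹' Ioi r = ⋃ h, ⋃ _ : r < ψ' h, (fun x => h⁻¹ • x) ⁻¹' A := by
      ext x
      simp only [mem_preimage, mem_Ioi, hlt, mem_iUnion, exists_prop]
      exact exists_congr fun h => and_comm
    rw [this]
    exact isOpen_iUnion fun h => isOpen_iUnion fun _ => hA.preimage (continuous_const_smul _)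
  · filter_upwards [eventually_forall_dist_mul_le ψ.continuous hψs hε] with k hk x
    rw [Subtype.dist_eq, Real.dist_eq, abs_le]
    have h1 := hshift ε hε.le k (fun h => by
      have := (abs_le.1 (hk (k⁻¹ * h))).2
      rw [mul_inv_cancel_left] at this
      linarith) x
    have h2 := hshift ε hε.le k⁻¹ (fun h => by
      have := (abs_le.1 (hk h)).1
      rw [inv_inv]
      linarith) (k • x)
    rw [inv_smul_smul] at h2
    constructor <;> linarith
  · refine le_antisymm (f x).2.2 ?_
    have h1 := hge x 1 (by simpa using hx)
    have h2 : ψ' 1 = 1 := Subtype.ext (hψ1 rfl)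
    rwa [h2] at h1
  · refine le_antisymm (not_lt.1 fun hpos => ?_) (f x).2.1
    obtain ⟨h, hhA, hh⟩ := (hlt x 0).1 hpos
    have hhN : h ∈ N := by
      by_contra hhN
      have h0 : ψ' h = 0 := Subtype.ext (hψN h hhN)
      exact hh.ne' h0
    exact hAB h hhN _ hhA (by simpa using hx)

end Thickening

/-! ### Splitting, disjoint closures and transfer of freeness -/

section Universal

variable {G : Type v} {X : Type u} [Group G] [TopologicalSpace G] [TopologicalSpace X]
  [MulAction G X]

/-- A continuous self-map of an irreducible extension over the base is the identity. -/
theorem IsIrreducibleMap.eq_id_of_comp_eq {Y Z : Type*} [TopologicalSpace Y] [T2Space Y]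
    {π : Y → Z} (hi : IsIrreducibleMap π) (hs : Function.Surjective π) {q : Y → Y}
    (hq : Continuous q) (hπ : ∀ y, π (q y) = π y) (y : Y) : q y = y := by
  by_contra hne
  obtain ⟨U, V, hU, hV, hyU, hyV, hd⟩ := t2_separation hne
  -- A full fiber lies in this set, and $q$ preserves it: its points are mapped into both $V$ and
  -- $U$.
  obtain ⟨x, hx⟩ := hi (V ∩ q ⁻¹' U) (hV.inter (hU.preimage hq)) ⟨y, hyV, hyU⟩
  obtain ⟨z, rfl⟩ := hs x
  have h1 : q z ∈ V := (hx (hπ z)).1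
  have h2 : q z ∈ U := (hx rfl).2
  exact hd.le_bot ⟨h2, h1⟩

/-- The composition of two irreducible extensions. -/
def IrreducibleExtension.comp [T2Space X] (E : IrreducibleExtension G X)
    (F : IrreducibleExtension G E.carrier) : IrreducibleExtension G X where
  carrier := F.carrier
  π := E.π ∘ F.π
  continuous_π := E.continuous_π.comp F.continuous_π
  equivariant_π g y := by simp [F.equivariant_π, E.equivariant_π]
  surjective_π := E.surjective_π.comp F.surjective_π
  irreducible_π U hU hne := by
    obtain ⟨z, hz⟩ := F.irreducible_π U hU hne
    obtain ⟨x, hx⟩ := E.irreducible_π (fiberCore F.π U) (fiberCore_isOpen F.continuous_π hU) ⟨z, hz⟩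
    exact ⟨x, fun y hy => hx (show F.π y ∈ E.π ⁻¹' {x} from hy) rfl⟩

/-- Every irreducible extension of a universal irreducible extension splits. -/
theorem IrreducibleExtension.IsUniversal.exists_section [T2Space X]
    {E : IrreducibleExtension G X} (hE : E.IsUniversal) (F : IrreducibleExtension G E.carrier) :
    ∃ p : E.carrier → F.carrier, Continuous p ∧ ∀ y, F.π (p y) = y := by
  -- Universality gives $p$ only over $X$; then $F.π\circ p$ is a self-map of $E$ over $X$, hence
  -- the identity.
  obtain ⟨p, hp, -, hπ⟩ := hE (E.comp F)
  exact ⟨p, hp, E.irreducible_π.eq_id_of_comp_eq E.surjective_π (F.continuous_π.comp hp) hπ⟩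

/-- In a universal irreducible extension, open sets have disjoint closures as soon as some
`N`-neighborhood of the first misses the second. -/
theorem IrreducibleExtension.IsUniversal.disjoint_closure [IsTopologicalGroup G] [T2Space G]
    [LocallyCompactSpace G] [T2Space X] {E : IrreducibleExtension G X} (hE : E.IsUniversal)
    {N : Set G} (hN : N ∈ 𝓝 (1 : G)) {A B : Set E.carrier} (hA : IsOpen A) (hB : IsOpen B)
    (hAB : ∀ n ∈ N, ∀ x ∈ A, n • x ∉ B) : Disjoint (closure A) (closure B) := by
  obtain ⟨f, hlsc, hf, hfA, hfB⟩ := exists_lowerSemicontinuous_of_smul_disjoint hN hA hAB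
  obtain ⟨F, Φ, hΦ, hext⟩ := exists_irreducibleExtension_of_lowerSemicontinuous hlsc hf
  obtain ⟨p, hp, hpπ⟩ := hE.exists_section F
  have hcont : Continuous (Φ ∘ p) := hΦ.comp hp
  have h1 : closure A ⊆ (Φ ∘ p) ⁻¹' {1} := closure_minimal
    (fun x hx => hext A 1 hA hfA (p x) (by rwa [hpπ])) (isClosed_singleton.preimage hcont)
  have h0 : closure B ⊆ (Φ ∘ p) ⁻¹' {0} := closure_minimal
    (fun x hx => hext B 0 hB hfB (p x) (by rwa [hpπ])) (isClosed_singleton.preimage hcont)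
  refine disjoint_left.2 fun x hxA hxB => ?_
  have : (1 : unitInterval) = 0 := (h1 hxA).symm.trans (h0 hxB)
  exact one_ne_zero this

/-- Topological freeness lifts to irreducible extensions. -/
theorem IsTopologicallyFreeFlow.of_irreducibleExtension [T2Space X]
    (h : IsTopologicallyFreeFlow G X) (E : IrreducibleExtension G X) :
    IsTopologicallyFreeFlow G E.carrier := by
  intro K hK h1
  by_contra hne
  obtain ⟨x, hx⟩ := E.irreducible_π _ isOpen_interior (nonempty_iff_ne_empty.2 hne)
  have hsub : fiberCore E.π (interior {y : E.carrier | ∃ k ∈ K, k • y = y}) ⊆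
      {x : X | ∃ k ∈ K, k • x = x} := by
    intro z hz
    obtain ⟨y, rfl⟩ := E.surjective_π z
    obtain ⟨k, hk, hky⟩ := interior_subset (hz rfl)
    exact ⟨k, hk, by rw [← E.equivariant_π, hky]⟩
  have hmem : x ∈ interior {x : X | ∃ k ∈ K, k • x = x} :=
    mem_interior.2 ⟨_, hsub, fiberCore_isOpen E.continuous_π isOpen_interior, hx⟩
  rw [h K hK h1] at hmem
  exact hmem

/-- A free flow is topologically free. -/
theorem IsFreeFlow.isTopologicallyFreeFlow {Y : Type*} [TopologicalSpace Y] [MulAction G Y]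
    (h : IsFreeFlow G Y) : IsTopologicallyFreeFlow G Y := by
  intro K _ h1
  have : {x : Y | ∃ k ∈ K, k • x = x} = ∅ := by
    refine eq_empty_of_forall_notMem ?_
    rintro x ⟨k, hk, hkx⟩
    exact h1 (h x (show k • x = (1 : G) • x by rw [hkx, one_smul]) ▸ hk)
  rw [this, interior_empty]

/-- Topological freeness descends along irreducible extensions. -/
theorem IrreducibleExtension.isTopologicallyFreeFlow_base [ContinuousSMul G X]
    (E : IrreducibleExtension G X) (h : IsTopologicallyFreeFlow G E.carrier) :
    IsTopologicallyFreeFlow G X := by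
  intro K hK h1
  by_contra hne
  obtain ⟨x, hx⟩ := nonempty_iff_ne_empty.2 hne
  obtain ⟨y, rfl⟩ := E.surjective_π x
  obtain ⟨U, hUsub, hU, ⟨z, hz⟩, hUK⟩ := h.exists_open_displaced hK h1
    (isOpen_interior.preimage E.continuous_π) ⟨y, hx⟩
  -- A point fixed by $k$ below need not have a fixed point above it, but $k$ preserves its fiber.
  -- As $U$ contains the whole fiber, $k$ cannot move $U$ off itself.
  obtain ⟨w, hw⟩ := E.irreducible_π U hU ⟨z, hz⟩
  obtain ⟨w, rfl⟩ := E.surjective_π w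
  obtain ⟨k, hk, hkw⟩ := interior_subset (hUsub (hw rfl))
  exact hUK k hk w (hw rfl) (hw (by simp [E.equivariant_π, hkw]))

/-- A topologically free universal irreducible extension is free. -/
theorem IrreducibleExtension.IsUniversal.isFreeFlow [IsTopologicalGroup G] [T2Space G]
    [LocallyCompactSpace G] [T2Space X] {E : IrreducibleExtension G X} (hE : E.IsUniversal)
    (h : IsTopologicallyFreeFlow G E.carrier) : IsFreeFlow G E.carrier := by
  suffices hfix : ∀ (g : G) (x : E.carrier), g • x = x → g = 1 by
    intro x g g' hgg'
    have := hfix (g'⁻¹ * g) x (by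
      rw [mul_smul, show g • x = g' • x from hgg', inv_smul_smul])
    exact (inv_mul_eq_one.1 this).symm
  intro g x hgx
  by_contra hg
  obtain ⟨K, hK, hK1, hKg⟩ : ∃ K : Set G, IsCompact K ∧ K ∈ 𝓝 (1 : G) ∧
      ∀ a ∈ K, ∀ b ∈ K, ∀ c ∈ K, a * b * g * c ≠ 1 := by
    have hcont : ContinuousAt (fun p : G × G × G => p.1 * p.2.1 * g * p.2.2) (1, 1, 1) := by
      fun_prop
    have hev : ∀ᶠ p : G × G × G in 𝓝 (1, 1, 1), p.1 * p.2.1 * g * p.2.2 ≠ 1 :=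
      hcont.eventually_ne (by simpa using hg)
    rw [nhds_prod_eq, nhds_prod_eq] at hev
    obtain ⟨P, hP, Q, hQ, hPQ⟩ := mem_prod_iff.1 hev
    obtain ⟨R, hR, S, hS, hRS⟩ := mem_prod_iff.1 hQ
    obtain ⟨K, hK1, hKsub, hK⟩ := local_compact_nhds (inter_mem hP (inter_mem hR hS))
    exact ⟨K, hK, hK1, fun a ha b hb c hc => hPQ (mk_mem_prod (hKsub ha).1
      (hRS (mk_mem_prod (hKsub hb).2.1 (hKsub hc).2.2)))⟩
  let N : Set G := K ∩ K⁻¹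
  have hNinv : ∀ n ∈ N, n⁻¹ ∈ N := fun n hn => ⟨hn.2, by simpa using hn.1⟩
  have hN : N ∈ 𝓝 (1 : G) := inter_mem hK1 (inv_mem_nhds_one G hK1)
  let D : Set G := (fun p : G × G × G => p.1 * p.2.1 * g * p.2.2) '' (K ×ˢ K ×ˢ K)
  have hD : IsCompact D := (hK.prod (hK.prod hK)).image (by fun_prop)
  have hD1 : (1 : G) ∉ D := by
    rintro ⟨⟨a, b, c⟩, ⟨ha, hb, hc⟩, habc⟩
    exact hKg a ha b hb c hc habc
  -- The coloring requires a symmetric compact set, hence $D\cup D^{-1}$.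
  obtain ⟨m, O, hO, hOD, hdense⟩ := h.exists_finite_coloring (C := D ∪ D⁻¹) (N := interior N)
    (hD.union hD.inv) (by simpa using hD1)
    (fun c hc => by simpa [or_comm] using hc) (interior_mem_nhds.2 hN)
    (fun n hn => interior_maximal (t := (·⁻¹) ⁻¹' interior N)
      (fun a ha => by simpa using hNinv _ (interior_subset ha))
      (isOpen_interior.preimage continuous_inv) (by simpa using hn))
  let A : Fin m → Set E.carrier := fun k => {y | ∃ n ∈ interior N, ∃ x ∈ O k, n • x = y}
  have hAopen : ∀ k, IsOpen (A k) := fun k => by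
    have : A k = ⋃ n ∈ interior N, (fun x => n⁻¹ • x) ⁻¹' O k := by
      ext y
      simp only [A, mem_ofPred_eq, mem_iUnion, mem_preimage, exists_prop]
      refine exists_congr fun n => and_congr_right fun _ => ⟨?_, fun hy => ⟨_, hy, by simp⟩⟩
      rintro ⟨x, hx, rfl⟩
      simpa using hx
    rw [this]
    exact isOpen_biUnion fun n _ => (hO k).preimage (continuous_const_smul _)
  obtain ⟨k, hk⟩ : ∃ k, x ∈ closure (A k) := by
    have hx : x ∈ closure (⋃ k, A k) := hdense x
    rwa [closure_iUnion_of_finite, mem_iUnion] at hx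
  have hgk : x ∈ closure ((fun y => g⁻¹ • y) ⁻¹' A k) := by
    have : (fun y : E.carrier => g⁻¹ • y) ⁻¹' closure (A k) ⊆
        closure ((fun y => g⁻¹ • y) ⁻¹' A k) :=
      (isOpenMap_smul g⁻¹).preimage_closure_subset_closure_preimage
    refine this ?_
    rw [mem_preimage, inv_smul_eq_iff.2 hgx.symm]
    exact hk
  refine disjoint_left.1 (hE.disjoint_closure hN (hAopen k)
    ((hAopen k).preimage (continuous_const_smul g⁻¹)) ?_) hk hgk
  -- If $nay=gbz$ with $y,z\in O_k$, then $a^{-1}n^{-1}gb\in D$ carries $z$ to $y$; this is why $D$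
  -- has the shape $KKgK$.
  rintro n hn _ ⟨a, ha, y, hy, rfl⟩ ⟨b, hb, z, hz, hzy⟩
  have hmem : a⁻¹ * n⁻¹ * g * b ∈ D :=
    ⟨(a⁻¹, n⁻¹, b), ⟨(interior_subset ha).2, hn.2, (interior_subset hb).1⟩, rfl⟩
  refine hOD k _ (Or.inl hmem) z hz ?_
  have : (a⁻¹ * n⁻¹ * g * b) • z = y := by
    simp only [mul_smul]
    rw [hzy]
    simp
  rwa [this]

end Universal

/-! ### The equivalences -/

theorem corollary5p6 (G : Type v) [Group G] [TopologicalSpace G] [IsTopologicalGroup G]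
    [T2Space G] [LocallyCompactSpace G]
    (X : Type u) [Nonempty X] [TopologicalSpace X] [CompactSpace X] [T2Space X]
    [MulAction G X] [ContinuousSMul G X] :
    [IsTopologicallyFreeFlow G X,
      IsFreeFlow G (UniversalIrreducibleFlow G X),
      stabilizerFlow G X = {trivialClosedSubgroup G}].TFAE ∧
    (IsGleasonComplete G X → (IsTopologicallyFreeFlow G X ↔ IsFreeFlow G X)) := by
  have hE := universalIrreducibleExtension_isUniversal G X
  have h12 : IsTopologicallyFreeFlow G X ↔ IsFreeFlow G (UniversalIrreducibleFlow G X) :=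
    ⟨fun h => hE.isFreeFlow (h.of_irreducibleExtension _), fun h =>
      (universalIrreducibleExtension G X).isTopologicallyFreeFlow_base h.isTopologicallyFreeFlow⟩
  refine ⟨?_, fun hG => ⟨fun h x g g' hgg' => ?_, IsFreeFlow.isTopologicallyFreeFlow⟩⟩
  · tfae_have 1 ↔ 2 := h12
    tfae_have 2 → 3 := by
      intro h
      have hst : ∀ z, stabilizerMap G (UniversalIrreducibleFlow G X) z =
          trivialClosedSubgroup G := by
        intro z
        refine SetLike.ext fun g => ?_
        change g • z = z ↔ g ∈ (⊥ : Subgroup G)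
        rw [Subgroup.mem_bot]
        refine ⟨fun hg => h z (show g • z = (1 : G) • z by rw [hg, one_smul]), ?_⟩
        rintro rfl
        exact one_smul G z
      -- An empty flow would have an empty stabilizer flow.
      obtain ⟨x⟩ := ‹Nonempty X›
      obtain ⟨z, -⟩ := (universalIrreducibleExtension G X).surjective_π x
      refine eq_singleton_iff_unique_mem.2 ⟨⟨z, hst z⟩, ?_⟩
      rintro _ ⟨w, rfl⟩
      exact hst w
    tfae_have 3 → 2 := by
      intro h z g g' hgg'
      have hz : stabilizerMap G (UniversalIrreducibleFlow G X) z = trivialClosedSubgroup G :=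
        h.subset (mem_range_self z)
      have hg : g'⁻¹ * g ∈ stabilizerMap G (UniversalIrreducibleFlow G X) z := by
        change (g'⁻¹ * g) • z = z
        rw [mul_smul, show g • z = g' • z from hgg', inv_smul_smul]
      rw [hz] at hg
      have hg1 : g'⁻¹ * g = 1 := Subgroup.mem_bot.1 hg
      exact (inv_mul_eq_one.1 hg1).symm
    tfae_finish
  -- Gleason completeness makes $π_X$ an equivariant bijection, which transports freeness to $X$.
  · obtain ⟨z, rfl⟩ := hG.surjective x
    refine h12.1 h z (hG.injective ?_)
    simpa only [(universalIrreducibleExtension G X).equivariant_π] using hgg'
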